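/- Let $1\le m\le n$ be integers and let $p\in[0,1]$. A street has $n$ spots numbered $1,\dots,n$ in order, all initially empty, and $m$ cars enter one after another; car $i$ has a preferred spot $a_i\in[n]=\{1,\dots,n\}$. A car parks in its preferred spot if that spot is unoccupied. Otherwise it tosses once a coin (independent of everything else) that shows heads with probability $p$ and tails with probability $1-p$: on heads it moves forward and parks in the first unoccupied spot with a larger number, on tails it moves backward and parks in the first unoccupied spot met (the unoccupied spot with the largest number smaller than $a_i$); if there is no such spot, the car fails to park. Let the preference list $\alpha=(a_1,\dots,a_m)$ be uniformly random in $[n]^m$, and write $\alpha\in \mathrm{PF}_{m,n}$ for the event that all $m$ cars park. Then this event has positive probability, and for every $j\in[n]$, $$\mathbb P(a_m=j\mid \alpha\in \mathrm{PF}_{m,n})=\frac{n-m+2}{(n-m+1)(n+1)}-\frac1{(n+1)^{m-1}}\left[p\sum_{s=n-j+1}^{m-1}\binom{m-1}{s}(n-s)^{m-s-2}(s+1)^{s-1}+(1-p)\sum_{s=j}^{m-1}\binom{m-1}{s}(n-s)^{m-s-2}(s+1)^{s-1}\right],$$ where a sum whose lower index exceeds its upper index is zero. -/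

import Mathlib

noncomputable section

namespace ProbParking

/-- The biased coin: `true` (heads) with probability `p`, `false` (tails) with probability `1 - p`. -/
def coin (p : unitInterval) : PMF Bool :=
  PMF.ofFintype
    (fun b => if b then ENNReal.ofReal (p : ℝ) else ENNReal.ofReal (1 - (p : ℝ)))
    (by
      rw [Fintype.sum_bool]
      simp only [if_true, Bool.false_eq_true, if_false]
      rw [← ENNReal.ofReal_add p.2.1 (sub_nonneg.2 p.2.2)]
      simp)

/-- The street has spots `0, …, n - 1` (the element `i : Fin n` is the spot numbered `i + 1`).
The first unoccupied spot strictly ahead of spot `a`, if there is one. -/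
def nextFree {n : ℕ} (occ : Finset (Fin n)) (a : Fin n) : Option (Fin n) :=
  if h : (Finset.univ.filter fun i => a < i ∧ i ∉ occ).Nonempty then
    some ((Finset.univ.filter fun i => a < i ∧ i ∉ occ).min' h)
  else none

/-- The first unoccupied spot met when backing up from spot `a`, if there is one. -/
def prevFree {n : ℕ} (occ : Finset (Fin n)) (a : Fin n) : Option (Fin n) :=
  if h : (Finset.univ.filter fun i => i < a ∧ i ∉ occ).Nonempty then
    some ((Finset.univ.filter fun i => i < a ∧ i ∉ occ).max' h)
  else none

/-- The (random) spot where a car with preference `a` parks when the spots in `occ` are occupied;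
`none` means that the car fails to park. If `a` is free the car parks there; otherwise one coin is
tossed, and the car goes forward on heads and backward on tails. -/
def parkCar {n : ℕ} (p : unitInterval) (occ : Finset (Fin n)) (a : Fin n) :
    PMF (Option (Fin n)) :=
  if a ∉ occ then PMF.pure (some a)
  else (coin p).map fun heads => if heads then nextFree occ a else prevFree occ a

/-- Cars with the listed preferences enter one after the other (with fresh coins), starting from
occupied spots `occ`. The outcome is `true` if all of them park and `false` otherwise. -/
def parkList {n : ℕ} (p : unitInterval) : Finset (Fin n) → List (Fin n) → PMF Bool
  | _, [] => PMF.pure true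
  | occ, a :: l =>
    (parkCar p occ a).bind fun spot =>
      match spot with
      | none => PMF.pure false
      | some i => parkList p (insert i occ) l

/-- The whole experiment: a uniformly random preference list `α` of `m` cars for `n` spots is
chosen, and then the cars enter an empty street in the order `0, …, m - 1`. The outcome is `α`
together with the truth value of "all cars park". -/
def experiment (m n : ℕ) [NeZero n] (p : unitInterval) : PMF ((Fin m → Fin n) × Bool) :=
  (PMF.uniformOfFintype (Fin m → Fin n)).bind fun α =>
    (parkList p ∅ (List.ofFn α)).map fun parked => (α, parked)

/-- The law of the experiment, as a probability measure. -/
def law (m n : ℕ) [NeZero n] (p : unitInterval) :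
    MeasureTheory.Measure ((Fin m → Fin n) × Bool) :=
  (experiment m n p).toMeasure

/-- The event that all cars park, i.e. that the preference list is a parking function. -/
def allPark (m n : ℕ) : Set ((Fin m → Fin n) × Bool) :=
  {ω | ω.2 = true}

/-- The event that the preference of the last of the `m ≥ 1` cars is the spot numbered `j`,
spots being numbered `1, …, n`. -/
def lastPref (m n : ℕ) (hm : 1 ≤ m) (j : ℕ) : Set ((Fin m → Fin n) × Bool) :=
  {ω | (ω.1 ⟨m - 1, by omega⟩ : ℕ) + 1 = j}

/-- The summand `C(m-1, s) (n-s)^(m-s-2) (s+1)^(s-1)`; the exponents are integers, and the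
exponent `m - s - 2` is `-1` when `s = m - 1`. -/
def summand (m n s : ℕ) : ℝ :=
  ((m - 1).choose s : ℝ) * ((n : ℝ) - s) ^ ((m : ℤ) - s - 2) * ((s : ℝ) + 1) ^ ((s : ℤ) - 1)

end ProbParking

end

namespace ProbParking

/-! Count preference lists weighted by their probability of success, and let `fillWeight p k S` be
the weight of those whose `k` cars end up exactly on `S`. After `k` cars, one more car preferring
`a` fails only on heads with every spot from `a` on occupied, or on tails with every spot up to `a`
occupied. So its weight of success is `totalWeight` minus `p` times a suffix weight and `1 - p`
times a prefix weight (`sum_fillWeight_mul_sum_moveWeight`). Reflecting the street swaps heads and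
tails, so a suffix weight is a prefix weight for `1 - p`.

Prefix weights are split by the first free spot `s`. No car ever crosses a spot that stays free, so
the two sides are independent experiments whose cars interleave in `k.choose s` ways
(`fillWeight_union`, `prefixWeight_eq_sum`).

Summing over `a` gives a recursion for `totalWeight`. Abel's identity solves it, and the solution
`(n-k+1)(n+1)^(k-1)` does not depend on `p` (`totalWeight_eq`). Substituted back, it turns prefix
weights into sums of `summand`; the conditional law is the quotient of the last car's weight by
`totalWeight p m n`. -/

open Classical in
/-- The weight with which a car that prefers `a` parks in the unoccupied spot `i`,
when the spots in `O` are occupied. -/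
noncomputable def moveWeight {α : Type*} [LinearOrder α] (p : ℝ) (O : Finset α) (a i : α) : ℝ :=
  (if a = i then 1 else 0) +
    p * (if a < i ∧ ∀ x, a ≤ x → x < i → x ∈ O then 1 else 0) +
    (1 - p) * (if i < a ∧ ∀ x, i < x → x ≤ a → x ∈ O then 1 else 0)

/-- For `S` of cardinality `k`, the total weight of the ways in which `k` cars occupy
exactly the spots in `S`. -/
noncomputable def fillWeight {α : Type*} [LinearOrder α] (p : ℝ) : ℕ → Finset α → ℝ
  | 0, _ => 1
  | k + 1, S => ∑ i ∈ S, fillWeight p k (S.erase i) * ∑ a ∈ S, moveWeight p (S.erase i) a i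

/-! ### Symmetries and factorization of the weights -/

section Order

variable {α β : Type*} [LinearOrder α] [LinearOrder β]

/-- A move depends on all spots between `a` and `i`, so the image of `e` must have no gaps. -/
theorem moveWeight_map (p : ℝ) (e : α ↪o β) (he : (Set.range e).OrdConnected)
    (O : Finset α) (a i : α) :
    moveWeight p (O.map e.toEmbedding) (e a) (e i) = moveWeight p O a i := by
  have h1 : (∀ x, e a ≤ x → x < e i → x ∈ O.map e.toEmbedding) ↔
      ∀ x, a ≤ x → x < i → x ∈ O := by
    constructor
    · intro h x hx hx'
      simpa using h (e x) (by simpa using hx) (by simpa using hx')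
    · intro h y hy hy'
      obtain ⟨x, rfl⟩ := he.out ⟨a, rfl⟩ ⟨i, rfl⟩ ⟨hy, hy'.le⟩
      simpa using h x (by simpa using hy) (by simpa using hy')
  have h2 : (∀ x, e i < x → x ≤ e a → x ∈ O.map e.toEmbedding) ↔
      ∀ x, i < x → x ≤ a → x ∈ O := by
    constructor
    · intro h x hx hx'
      simpa using h (e x) (by simpa using hx) (by simpa using hx')
    · intro h y hy hy'
      obtain ⟨x, rfl⟩ := he.out ⟨i, rfl⟩ ⟨a, rfl⟩ ⟨hy.le, hy'⟩
      simpa using h x (by simpa using hy) (by simpa using hy')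
  classical
  unfold moveWeight
  simp only [h1, h2, e.lt_iff_lt, e.injective.eq_iff]

theorem fillWeight_map (p : ℝ) (e : α ↪o β) (he : (Set.range e).OrdConnected) (k : ℕ)
    (S : Finset α) : fillWeight p k (S.map e.toEmbedding) = fillWeight p k S := by
  induction k generalizing S with
  | zero => rfl
  | succ k ih =>
    simp only [fillWeight, Finset.sum_map]
    refine Finset.sum_congr rfl fun i _ => ?_
    rw [← Finset.map_erase, ih]
    congr 1
    exact Finset.sum_congr rfl fun a _ => moveWeight_map p e he _ a i

theorem moveWeight_rev {n : ℕ} (p : ℝ) (O : Finset (Fin n)) (a i : Fin n) :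
    moveWeight p (O.map Fin.revPerm.toEmbedding) (Fin.rev a) (Fin.rev i) =
      moveWeight (1 - p) O a i := by
  have hm : ∀ x : Fin n, x ∈ O.map Fin.revPerm.toEmbedding ↔ Fin.rev x ∈ O := by
    intro x
    simp only [Finset.mem_map_equiv, Fin.revPerm_symm, Fin.revPerm_apply]
  have h1 : (∀ x, Fin.rev a ≤ x → x < Fin.rev i → x ∈ O.map Fin.revPerm.toEmbedding) ↔
      ∀ x, i < x → x ≤ a → x ∈ O := by
    rw [← Fin.revPerm.forall_congr_right]
    simp only [hm, Fin.revPerm_apply, Fin.rev_rev, Fin.rev_lt_rev, Fin.rev_le_rev]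
    exact forall_congr' fun x => forall_comm
  have h2 : (∀ x, Fin.rev i < x → x ≤ Fin.rev a → x ∈ O.map Fin.revPerm.toEmbedding) ↔
      ∀ x, a ≤ x → x < i → x ∈ O := by
    rw [← Fin.revPerm.forall_congr_right]
    simp only [hm, Fin.revPerm_apply, Fin.rev_rev, Fin.rev_lt_rev, Fin.rev_le_rev]
    exact forall_congr' fun x => forall_comm
  classical
  unfold moveWeight
  simp only [h1, h2, Fin.rev_lt_rev, Fin.rev_inj, sub_sub_cancel]
  rw [add_right_comm]
  congr!

theorem fillWeight_rev {n : ℕ} (p : ℝ) (k : ℕ) (S : Finset (Fin n)) :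
    fillWeight p k (S.map Fin.revPerm.toEmbedding) = fillWeight (1 - p) k S := by
  induction k generalizing S with
  | zero => rfl
  | succ k ih =>
    simp only [fillWeight, Finset.sum_map]
    refine Finset.sum_congr rfl fun i _ => ?_
    rw [← Finset.map_erase, ih]
    congr 1
    exact Finset.sum_congr rfl fun a _ => moveWeight_rev p _ a i

theorem moveWeight_congr (p : ℝ) {O O' : Finset α} {a i : α}
    (h : ∀ x, min a i ≤ x → x ≤ max a i → (x ∈ O ↔ x ∈ O')) :
    moveWeight p O a i = moveWeight p O' a i := by
  classical
  unfold moveWeight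
  have h1 : (a < i ∧ ∀ x, a ≤ x → x < i → x ∈ O) ↔ (a < i ∧ ∀ x, a ≤ x → x < i → x ∈ O') := by
    refine and_congr_right fun hai => forall_congr' fun x => ?_
    refine forall_congr' fun hx => forall_congr' fun hx' => h x ?_ ?_
    · simp [hx]
    · simp [hx'.le]
  have h2 : (i < a ∧ ∀ x, i < x → x ≤ a → x ∈ O) ↔ (i < a ∧ ∀ x, i < x → x ≤ a → x ∈ O') := by
    refine and_congr_right fun hai => forall_congr' fun x => ?_
    refine forall_congr' fun hx => forall_congr' fun hx' => h x ?_ ?_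
    · simp [hx.le]
    · simp [hx']
  simp only [h1, h2]

theorem moveWeight_eq_zero (p : ℝ) {O : Finset α} {a i x : α} (hai : a ≠ i) (hx : x ∉ O)
    (h : (a ≤ x ∧ x < i) ∨ (i < x ∧ x ≤ a)) : moveWeight p O a i = 0 := by
  classical
  unfold moveWeight
  rw [if_neg hai, if_neg, if_neg]
  · simp
  · rintro ⟨h1, h2⟩
    rcases h with h | h
    · exact absurd (h.1.trans_lt h.2) h1.not_gt
    · exact hx (h2 x h.1 h.2)
  · rintro ⟨h1, h2⟩
    rcases h with h | h
    · exact hx (h2 x h.1 h.2)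
    · exact absurd (h.1.trans_le h.2) h1.not_gt

/-- The free spot `x` stops any car coming from `B`, and a move within `A` never looks beyond `x`.
-/
theorem sum_moveWeight_union_left (p : ℝ) {A B : Finset α} {x i : α} (hA : ∀ y ∈ A, y < x)
    (hB : ∀ y ∈ B, x < y) (hi : i ∈ A) :
    ∑ a ∈ A ∪ B, moveWeight p ((A ∪ B).erase i) a i = ∑ a ∈ A, moveWeight p (A.erase i) a i := by
  have hd : Disjoint A B := Finset.disjoint_left.2 fun y h h' => (hA y h).not_gt (hB y h')
  have hx : x ∉ (A ∪ B).erase i := by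
    intro h
    rcases Finset.mem_union.1 (Finset.mem_of_mem_erase h) with h | h
    · exact lt_irrefl _ (hA x h)
    · exact lt_irrefl _ (hB x h)
  rw [Finset.sum_union hd, Finset.sum_eq_zero (s := B), add_zero]
  · refine Finset.sum_congr rfl fun a ha => moveWeight_congr p fun y _ hy => ?_
    have hyx : y < x := hy.trans_lt (max_lt (hA a ha) (hA i hi))
    have : y ∉ B := fun h => (hB y h).not_gt hyx
    simp [this]
  · intro a ha
    exact moveWeight_eq_zero p ((hA i hi).trans (hB a ha)).ne' hx
      (Or.inr ⟨hA i hi, (hB a ha).le⟩)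

theorem sum_moveWeight_union_right (p : ℝ) {A B : Finset α} {x i : α} (hA : ∀ y ∈ A, y < x)
    (hB : ∀ y ∈ B, x < y) (hi : i ∈ B) :
    ∑ a ∈ A ∪ B, moveWeight p ((A ∪ B).erase i) a i = ∑ a ∈ B, moveWeight p (B.erase i) a i := by
  have hd : Disjoint A B := Finset.disjoint_left.2 fun y h h' => (hA y h).not_gt (hB y h')
  have hx : x ∉ (A ∪ B).erase i := by
    intro h
    rcases Finset.mem_union.1 (Finset.mem_of_mem_erase h) with h | h
    · exact lt_irrefl _ (hA x h)
    · exact lt_irrefl _ (hB x h)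
  rw [Finset.sum_union hd, Finset.sum_eq_zero (s := A), zero_add]
  · refine Finset.sum_congr rfl fun a ha => moveWeight_congr p fun y hy _ => ?_
    have hyx : x < y := (lt_min (hB a ha) (hB i hi)).trans_le hy
    have : y ∉ A := fun h => (hA y h).not_gt hyx
    simp [this]
  · intro a ha
    exact moveWeight_eq_zero p ((hA a ha).trans (hB i hi)).ne hx
      (Or.inl ⟨(hA a ha).le, hB i hi⟩)

/-- The free spot `x` decouples the two sides; the factorials, kept free of division, count the
interleavings of their cars. The induction removes the last car, which parked in `A` or in `B`. -/
theorem fillWeight_union (p : ℝ) (k : ℕ) {A B : Finset α} {x : α} (hA : ∀ y ∈ A, y < x)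
    (hB : ∀ y ∈ B, x < y) (hk : A.card + B.card = k) :
    fillWeight p k (A ∪ B) * (A.card.factorial * B.card.factorial) =
      k.factorial * (fillWeight p A.card A * fillWeight p B.card B) := by
  induction k generalizing A B with
  | zero =>
    obtain ⟨hA', hB'⟩ := Nat.add_eq_zero_iff.1 hk
    simp [fillWeight, hA', hB']
  | succ k ih =>
    have hd : Disjoint A B := Finset.disjoint_left.2 fun y h h' => (hA y h).not_gt (hB y h')
    -- The recursion of `fillWeight` in a form that also covers `C = ∅`, where both sides vanish.
    have key : ∀ C : Finset α, ∑ i ∈ C, fillWeight p (C.card - 1) (C.erase i) *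
        ∑ a ∈ C, moveWeight p (C.erase i) a i * C.card = C.card * fillWeight p C.card C := by
      intro C
      rcases h : C.card with _ | c
      · simp
      · simp only [fillWeight, Nat.add_sub_cancel]
        rw [Finset.mul_sum]
        refine Finset.sum_congr rfl fun i _ => ?_
        rw [← Finset.sum_mul]
        ring
    have h1 : (∑ i ∈ A, fillWeight p k ((A ∪ B).erase i) *
        ∑ a ∈ A ∪ B, moveWeight p ((A ∪ B).erase i) a i) *
          (A.card.factorial * B.card.factorial) =
        k.factorial * (A.card * fillWeight p A.card A * fillWeight p B.card B) := by
      rw [← key A, Finset.sum_mul, Finset.sum_mul, Finset.mul_sum]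
      refine Finset.sum_congr rfl fun i hi => ?_
      have hiB : i ∉ B := Finset.disjoint_left.1 hd hi
      have hc : (A.erase i).card = A.card - 1 := Finset.card_erase_of_mem hi
      have hpos : 0 < A.card := Finset.card_pos.2 ⟨i, hi⟩
      have := ih (A := A.erase i) (B := B) (fun y hy => hA y (Finset.mem_of_mem_erase hy)) hB
        (by omega)
      rw [hc] at this
      rw [sum_moveWeight_union_left p hA hB hi, Finset.erase_union_distrib,
        Finset.erase_eq_of_notMem hiB, ← Finset.sum_mul, ← Nat.mul_factorial_pred hpos.ne']
      push_cast
      linear_combination (A.card : ℝ) * (∑ a ∈ A, moveWeight p (A.erase i) a i) * this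
    have h2 : (∑ i ∈ B, fillWeight p k ((A ∪ B).erase i) *
        ∑ a ∈ A ∪ B, moveWeight p ((A ∪ B).erase i) a i) *
          (A.card.factorial * B.card.factorial) =
        k.factorial * (fillWeight p A.card A * (B.card * fillWeight p B.card B)) := by
      rw [← key B, Finset.sum_mul, Finset.mul_sum, Finset.mul_sum]
      refine Finset.sum_congr rfl fun i hi => ?_
      have hiA : i ∉ A := Finset.disjoint_right.1 hd hi
      have hc : (B.erase i).card = B.card - 1 := Finset.card_erase_of_mem hi
      have hpos : 0 < B.card := Finset.card_pos.2 ⟨i, hi⟩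
      have := ih (A := A) (B := B.erase i) hA (fun y hy => hB y (Finset.mem_of_mem_erase hy))
        (by omega)
      rw [hc] at this
      rw [sum_moveWeight_union_right p hA hB hi, Finset.erase_union_distrib,
        Finset.erase_eq_of_notMem hiA, ← Finset.sum_mul, ← Nat.mul_factorial_pred hpos.ne']
      push_cast
      linear_combination (B.card : ℝ) * (∑ a ∈ B, moveWeight p (B.erase i) a i) * this
    have hk' : (A.card : ℝ) + B.card = k + 1 := by exact_mod_cast hk
    rw [fillWeight, Finset.sum_union hd, add_mul, h1, h2, Nat.factorial_succ]
    push_cast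
    linear_combination (k.factorial : ℝ) * fillWeight p A.card A * fillWeight p B.card B * hk'

end Order

/-! ### Abel's identity -/

/-- Abel's generalization of the binomial theorem. -/
theorem sum_choose_mul_abel {x : ℝ} (hx : 0 < x) (N : ℕ) (y : ℝ) :
    ∑ i ∈ Finset.range (N + 1),
      (N.choose i : ℝ) * (x * (x + i) ^ ((i : ℤ) - 1)) * (y - i) ^ (N - i) = (x + y) ^ N := by
  induction N generalizing y with
  | zero => simp [hx.ne']
  | succ N ih =>
    set f : ℝ → ℝ := fun y => ∑ i ∈ Finset.range (N + 1 + 1),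
      ((N + 1).choose i : ℝ) * (x * (x + i) ^ ((i : ℤ) - 1)) * (y - i) ^ (N + 1 - i) with hf
    -- Differentiating in `y` reduces to the case `N`, so both sides have the same derivative and
    -- need only agree at `y = -x`.
    have hd : ∀ y, HasDerivAt f ((N + 1) * (x + y) ^ N) y := by
      intro y
      have h : HasDerivAt f (∑ i ∈ Finset.range (N + 1 + 1),
          ((N + 1).choose i : ℝ) * (x * (x + i) ^ ((i : ℤ) - 1)) *
            (((N + 1 - i : ℕ) : ℝ) * (y - i) ^ (N + 1 - i - 1) * 1)) y :=
        HasDerivAt.fun_sum fun i _ =>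
          (((hasDerivAt_id y).sub_const (i : ℝ)).pow _).const_mul _
      convert h using 1
      rw [← ih y, Finset.sum_range_succ _ (N + 1), Finset.mul_sum]
      simp only [Nat.sub_self, Nat.cast_zero, zero_mul, mul_zero, add_zero]
      refine Finset.sum_congr rfl fun i hi => ?_
      have hi' : i ≤ N := Finset.mem_range_succ_iff.1 hi
      have hc : ((N + 1).choose i : ℝ) * ((N + 1 - i : ℕ) : ℝ) = (N + 1) * N.choose i := by
        have := Nat.choose_mul_succ_eq N i
        have h2 : ((N.choose i * (N + 1) : ℕ) : ℝ) = ((N + 1).choose i * (N + 1 - i) : ℕ) := by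
          rw [this]
        push_cast at h2 ⊢
        linarith
      have he : N + 1 - i - 1 = N - i := by omega
      rw [he]
      linear_combination -(x * (x + i) ^ ((i : ℤ) - 1)) * (y - i) ^ (N - i) * hc
    -- At `y = -x` the powers of `x + i` combine to exponent `N`, leaving an `(N+1)`-th finite
    -- difference of a polynomial of degree `N`.
    have h0 : f (-x) = 0 := by
      have h1 := congrFun (fwdDiff_iter_pow_eq_zero_of_lt (R := ℝ) (Nat.lt_succ_self N)) x
      rw [fwdDiff_iter_eq_sum_shift] at h1
      simp only [Pi.zero_apply, nsmul_eq_mul, mul_one, zsmul_eq_mul] at h1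
      rw [← mul_zero x, ← h1, hf, Finset.mul_sum]
      refine Finset.sum_congr rfl fun i hi => ?_
      have hi' : i ≤ N + 1 := Finset.mem_range_succ_iff.1 hi
      have hxi : x + i ≠ 0 := by positivity
      have e1 : (-x - i : ℝ) ^ (N + 1 - i) = (-1) ^ (N + 1 - i) * (x + i) ^ (N + 1 - i) := by
        rw [← mul_pow]; ring
      have e2 : (x + i) ^ ((i : ℤ) - 1) * (x + i) ^ (N + 1 - i) = (x + i) ^ N := by
        rw [← zpow_natCast (x + i) (N + 1 - i), ← zpow_add₀ hxi, ← zpow_natCast]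
        congr 1
        omega
      rw [e1, ← e2]
      push_cast
      ring
    have hg : ∀ y, HasDerivAt (fun y => f y - (x + y) ^ (N + 1)) 0 y := by
      intro y
      have h := (hd y).sub (((hasDerivAt_id y).const_add x).pow (N + 1))
      refine h.congr_deriv ?_
      push_cast
      simp
    have hc := is_const_of_deriv_eq_zero (fun y => (hg y).differentiableAt)
      (fun y => (hg y).deriv) y (-x)
    simp only [h0] at hc
    simpa [sub_eq_zero] using hc

/-! ### Decomposition by the first free spot -/

/-- The total weight of the ways in which `k` cars park on the spots `0, …, n - 1`. -/
noncomputable def totalWeight (p : ℝ) (k n : ℕ) : ℝ :=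
  ∑ S ∈ Finset.powersetCard k (Finset.range n), fillWeight p k S

/-- The total weight of the ways in which `k` cars park on the spots `0, …, n - 1`
so that the spots `0, …, j - 1` all get occupied. -/
noncomputable def prefixWeight (p : ℝ) (k n j : ℕ) : ℝ :=
  ∑ S ∈ Finset.powersetCard k (Finset.range n), if Finset.range j ⊆ S then fillWeight p k S else 0

/-- The order embedding of `ℕ` in itself that adds `t`. -/
def shiftEmbedding (t : ℕ) : ℕ ↪o ℕ :=
  OrderEmbedding.ofStrictMono (fun i => i + t) fun _ _ h => Nat.add_lt_add_right h t

theorem range_shiftEmbedding_ordConnected (t : ℕ) :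
    (Set.range (shiftEmbedding t)).OrdConnected := by
  refine ⟨?_⟩
  rintro _ ⟨a, rfl⟩ _ ⟨b, rfl⟩ x ⟨hx, -⟩
  have hx : a + t ≤ x := hx
  exact ⟨x - t, Nat.sub_add_cancel (by omega)⟩

theorem mem_map_shiftEmbedding {t x : ℕ} {B : Finset ℕ} :
    x ∈ B.map (shiftEmbedding t).toEmbedding ↔ ∃ b ∈ B, b + t = x := by
  rw [Finset.mem_map]
  rfl

theorem totalWeight_self (p : ℝ) (s : ℕ) :
    totalWeight p s s = fillWeight p s (Finset.range s) := by
  have : Finset.powersetCard s (Finset.range s) = {Finset.range s} := by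
    simpa using Finset.powersetCard_self (Finset.range s)
  rw [totalWeight, this, Finset.sum_singleton]

theorem fillWeight_range_union_shift (p : ℝ) {s k : ℕ} (hs : s ≤ k) {B : Finset ℕ}
    (hB : B.card = k - s) :
    fillWeight p k (Finset.range s ∪ B.map (shiftEmbedding (s + 1)).toEmbedding) =
      k.choose s * totalWeight p s s * fillWeight p (k - s) B := by
  have h := fillWeight_union p k (A := Finset.range s)
    (B := B.map (shiftEmbedding (s + 1)).toEmbedding) (x := s) (fun y hy => Finset.mem_range.1 hy)
    (by
      intro y hy
      obtain ⟨b, -, rfl⟩ := mem_map_shiftEmbedding.1 hy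
      omega)
    (by rw [Finset.card_map, hB, Finset.card_range]; omega)
  rw [Finset.card_map, hB, Finset.card_range,
    fillWeight_map p _ (range_shiftEmbedding_ordConnected _), ← totalWeight_self] at h
  have hc : ((k.choose s * s.factorial * (k - s).factorial : ℕ) : ℝ) = k.factorial := by
    rw [Nat.choose_mul_factorial_mul_factorial hs]
  push_cast at hc
  have hne : ((s.factorial : ℝ) * (k - s).factorial) ≠ 0 := by positivity
  refine mul_right_cancel₀ hne ?_
  rw [h, ← hc]
  ring

/-- Such an `S` is a full block of `s` spots, the gap `s`, and an arbitrary set on the remaining `n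
- s - 1` spots. -/
theorem sum_fillWeight_firstFree (p : ℝ) {s k n : ℕ} (hs : s ≤ k) (hk : k < n) :
    ∑ S ∈ Finset.powersetCard k (Finset.range n) with Finset.range s ⊆ S ∧ s ∉ S,
      fillWeight p k S =
    k.choose s * totalWeight p s s * totalWeight p (k - s) (n - s - 1) := by
  rw [totalWeight, totalWeight, Finset.mul_sum, ← totalWeight]
  symm
  refine Finset.sum_bij
    (fun B _ => Finset.range s ∪ B.map (shiftEmbedding (s + 1)).toEmbedding) ?_ ?_ ?_ ?_
  · intro B hB
    obtain ⟨hB, hc⟩ := Finset.mem_powersetCard.1 hB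
    simp only [Finset.mem_filter, Finset.mem_powersetCard, Finset.subset_union_left, true_and,
      Finset.mem_union, Finset.mem_range, lt_irrefl, false_or, mem_map_shiftEmbedding]
    refine ⟨⟨?_, ?_⟩, ?_⟩
    · intro x hx
      rw [Finset.mem_union, mem_map_shiftEmbedding, Finset.mem_range] at hx
      rw [Finset.mem_range]
      rcases hx with hx | ⟨b, hb, rfl⟩
      · omega
      · have := Finset.mem_range.1 (hB hb)
        omega
    · rw [Finset.card_union_of_disjoint, Finset.card_map, hc, Finset.card_range]
      · omega
      · rw [Finset.disjoint_left]
        intro x hx hx'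
        obtain ⟨b, -, rfl⟩ := mem_map_shiftEmbedding.1 hx'
        have := Finset.mem_range.1 hx
        omega
    · rintro ⟨b, -, hb⟩
      omega
  · intro B _ B' _ h
    ext b
    have h1 := congrArg (fun S => b + (s + 1) ∈ S) h
    simp only [Finset.mem_union, Finset.mem_range, mem_map_shiftEmbedding, eq_iff_iff] at h1
    have h2 : ¬ b + (s + 1) < s := by omega
    simpa [h2] using h1
  · intro S hS
    obtain ⟨hS, hs1, hs2⟩ := Finset.mem_filter.1 hS
    obtain ⟨hS, hc⟩ := Finset.mem_powersetCard.1 hS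
    have hU : Finset.range s ∪ ((Finset.range (n - s - 1)).filter
        fun b => b + (s + 1) ∈ S).map (shiftEmbedding (s + 1)).toEmbedding = S := by
      ext x
      rw [Finset.mem_union, mem_map_shiftEmbedding]
      constructor
      · rintro (h | ⟨b, hb, rfl⟩)
        · exact hs1 h
        · exact (Finset.mem_filter.1 hb).2
      · intro hx
        have hxn := Finset.mem_range.1 (hS hx)
        rcases lt_trichotomy x s with h | rfl | h
        · exact Or.inl (Finset.mem_range.2 h)
        · exact absurd hx hs2
        · have e : x - (s + 1) + (s + 1) = x := by omega
          refine Or.inr ⟨x - (s + 1), ?_, e⟩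
          rw [Finset.mem_filter, Finset.mem_range, e]
          exact ⟨by omega, hx⟩
    refine ⟨_, ?_, hU⟩
    rw [Finset.mem_powersetCard]
    refine ⟨Finset.filter_subset _ _, ?_⟩
    have := congrArg Finset.card hU
    rw [Finset.card_union_of_disjoint, Finset.card_map, hc, Finset.card_range] at this
    · omega
    · rw [Finset.disjoint_left]
      intro x hx hx'
      obtain ⟨b, -, rfl⟩ := mem_map_shiftEmbedding.1 hx'
      have := Finset.mem_range.1 hx
      omega
  · intro B hB
    exact (fillWeight_range_union_shift p hs (Finset.mem_powersetCard.1 hB).2).symm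

/-- Only the least element `t` outside `S` contributes. It satisfies `t ≤ S.card`, and `t ≥ j`
exactly when the first `j` spots lie in `S`. -/
theorem sum_Icc_firstFree_eq (S : Finset ℕ) (j : ℕ) (c : ℝ) :
    ∑ s ∈ Finset.Icc j S.card, (if Finset.range s ⊆ S ∧ s ∉ S then c else 0) =
      if Finset.range j ⊆ S then c else 0 := by
  classical
  have hex : ∃ s, s ∉ S := Infinite.exists_notMem_finset S
  set t := Nat.find hex with ht
  have htS : t ∉ S := Nat.find_spec hex
  have hlt : ∀ x, x < t → x ∈ S := fun x hx => not_not.1 (Nat.find_min hex hx)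
  have hsub : ∀ s, Finset.range s ⊆ S ↔ s ≤ t := by
    intro s
    constructor
    · intro h
      by_contra hs
      exact htS (h (Finset.mem_range.2 (not_le.1 hs)))
    · intro h x hx
      exact hlt x ((Finset.mem_range.1 hx).trans_le h)
  have hiff : ∀ s, (Finset.range s ⊆ S ∧ s ∉ S) ↔ s = t := by
    intro s
    rw [hsub]
    constructor
    · rintro ⟨h, h'⟩
      exact h.antisymm (not_lt.1 fun hs => h' (hlt s hs))
    · rintro rfl
      exact ⟨le_rfl, htS⟩
  have htc : t ≤ S.card := by
    have := Finset.card_le_card ((hsub t).2 le_rfl)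
    rwa [Finset.card_range] at this
  simp only [hiff]
  rw [Finset.sum_ite_eq']
  simp only [Finset.mem_Icc, htc, and_true, hsub]

theorem prefixWeight_eq_sum (p : ℝ) {k n : ℕ} (hk : k < n) (j : ℕ) :
    prefixWeight p k n j = ∑ s ∈ Finset.Icc j k,
      k.choose s * totalWeight p s s * totalWeight p (k - s) (n - s - 1) := by
  calc prefixWeight p k n j = ∑ S ∈ Finset.powersetCard k (Finset.range n),
        ∑ s ∈ Finset.Icc j k,
          (if Finset.range s ⊆ S ∧ s ∉ S then fillWeight p k S else 0) := by
        refine Finset.sum_congr rfl fun S hS => ?_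
        rw [← sum_Icc_firstFree_eq, (Finset.mem_powersetCard.1 hS).2]
    _ = _ := by
        rw [Finset.sum_comm]
        refine Finset.sum_congr rfl fun s hs => ?_
        rw [← sum_fillWeight_firstFree p (Finset.mem_Icc.1 hs).2 hk, Finset.sum_filter]

/-- A configuration with first free spot `s` is counted once for each `j` from `1` to `s`, whence
the factor `s`. -/
theorem sum_prefixWeight (p : ℝ) {k n : ℕ} (hk : k < n) :
    ∑ j ∈ Finset.Icc 1 n, prefixWeight p k n j = ∑ s ∈ Finset.range (k + 1),
      s * (k.choose s * totalWeight p s s * totalWeight p (k - s) (n - s - 1)) := by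
  simp only [prefixWeight_eq_sum p hk]
  rw [Finset.sum_comm' (t' := Finset.range (k + 1)) (s' := fun s => Finset.Icc 1 s)]
  · refine Finset.sum_congr rfl fun s _ => ?_
    simp
  · intro j s
    simp only [Finset.mem_Icc, Finset.mem_range]
    omega

/-! ### Transfer to `Fin n` and reflection -/

theorem sum_powersetCard_univ_fin (k n : ℕ) (g : Finset ℕ → ℝ) :
    ∑ O ∈ Finset.powersetCard k (Finset.univ : Finset (Fin n)), g (O.map Fin.valEmbedding) =
      ∑ S ∈ Finset.powersetCard k (Finset.range n), g S := by
  have h : Finset.range n = (Finset.univ : Finset (Fin n)).map Fin.valEmbedding := by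
    ext x
    simp
  rw [h, Finset.powersetCard_map, Finset.sum_map]
  rfl

theorem fillWeight_map_val {n : ℕ} (p : ℝ) (k : ℕ) (O : Finset (Fin n)) :
    fillWeight p k (O.map Fin.valEmbedding) = fillWeight p k O := by
  refine fillWeight_map p (Fin.valOrderEmb n) ⟨?_⟩ k O
  rintro _ ⟨a, rfl⟩ _ ⟨b, rfl⟩ x ⟨-, hx⟩
  have hx : x ≤ (b : ℕ) := hx
  exact ⟨⟨x, hx.trans_lt b.2⟩, rfl⟩

theorem totalWeight_eq_sum_fin (p : ℝ) (k n : ℕ) :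
    totalWeight p k n =
      ∑ O ∈ Finset.powersetCard k (Finset.univ : Finset (Fin n)), fillWeight p k O := by
  rw [totalWeight, ← sum_powersetCard_univ_fin]
  simp only [fillWeight_map_val]

open Classical in
theorem prefixWeight_eq_sum_fin (p : ℝ) (k : ℕ) {n : ℕ} (a : Fin n) :
    prefixWeight p k n (a + 1) =
      ∑ O ∈ Finset.powersetCard k (Finset.univ : Finset (Fin n)),
        fillWeight p k O * if ∀ x, x ≤ a → x ∈ O then 1 else 0 := by
  rw [prefixWeight, ← sum_powersetCard_univ_fin]
  refine Finset.sum_congr rfl fun O _ => ?_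
  have h : Finset.range (a + 1) ⊆ O.map Fin.valEmbedding ↔ ∀ x, x ≤ a → x ∈ O := by
    constructor
    · intro h x hx
      have := h (Finset.mem_range.2 (Nat.lt_succ_of_le (show (x : ℕ) ≤ a from hx)))
      exact (Finset.mem_map' Fin.valEmbedding).1 this
    · intro h x hx
      have hx : x < a + 1 := Finset.mem_range.1 hx
      exact Finset.mem_map.2 ⟨⟨x, by omega⟩, h _ (Fin.le_def.2 (by simpa using by omega)), rfl⟩
  simp only [h, fillWeight_map_val, mul_ite, mul_one, mul_zero]

open Classical in
theorem suffixWeight_eq_sum_fin (p : ℝ) (k : ℕ) {n : ℕ} (a : Fin n) :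
    prefixWeight (1 - p) k n (n - a) =
      ∑ O ∈ Finset.powersetCard k (Finset.univ : Finset (Fin n)),
        fillWeight p k O * if ∀ x, a ≤ x → x ∈ O then 1 else 0 := by
  have e : n - (a : ℕ) = (Fin.rev a : ℕ) + 1 := by
    rw [Fin.val_rev]
    omega
  have hu : (Finset.univ : Finset (Fin n)) = Finset.univ.map Fin.revPerm.toEmbedding := by simp
  rw [e, prefixWeight_eq_sum_fin]
  conv_rhs => rw [hu, Finset.powersetCard_map, Finset.sum_map]
  refine Finset.sum_congr rfl fun O _ => ?_
  have h : (∀ x, a ≤ x → x ∈ O.map Fin.revPerm.toEmbedding) ↔ ∀ x, x ≤ Fin.rev a → x ∈ O := by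
    rw [← Fin.revPerm.forall_congr_right]
    simp only [Finset.mem_map_equiv, Fin.revPerm_symm, Fin.revPerm_apply, Fin.rev_rev,
      Fin.le_rev_iff]
  change _ = fillWeight p k (O.map Fin.revPerm.toEmbedding) *
    if ∀ x, a ≤ x → x ∈ O.map Fin.revPerm.toEmbedding then 1 else 0
  rw [fillWeight_rev]
  simp only [h]

/-! ### Adding one car -/

section Step

variable {α : Type*} [LinearOrder α] [Fintype α]

/-- Summing over the last car: the weights of the ways to fill sets of size `k + 1`. -/
theorem sum_fillWeight_succ (p : ℝ) (k : ℕ) (V : Finset α → ℝ) :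
    ∑ S ∈ Finset.powersetCard (k + 1) Finset.univ, fillWeight p (k + 1) S * V S =
      ∑ O ∈ Finset.powersetCard k Finset.univ, fillWeight p k O *
        ∑ a, ∑ i ∈ Oᶜ, moveWeight p O a i * V (insert i O) := by
  -- A car that parks at `i` preferred `i` or an occupied spot, so preferences outside `insert i O`
  -- have weight zero.
  have hS : ∀ (O : Finset α) (i : α), i ∉ O →
      ∑ a ∈ insert i O, moveWeight p O a i = ∑ a, moveWeight p O a i := by
    intro O i hi
    refine Finset.sum_subset (Finset.subset_univ _) fun a _ ha => ?_
    rw [Finset.mem_insert, not_or] at ha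
    rcases lt_or_gt_of_ne ha.1 with h | h
    · exact moveWeight_eq_zero p ha.1 ha.2 (Or.inl ⟨le_rfl, h⟩)
    · exact moveWeight_eq_zero p ha.1 ha.2 (Or.inr ⟨h, le_rfl⟩)
  have hL : ∀ S ∈ Finset.powersetCard (k + 1) (Finset.univ : Finset α),
      fillWeight p (k + 1) S * V S = ∑ i ∈ S, fillWeight p k (S.erase i) *
        (∑ a, moveWeight p (S.erase i) a i) * V (insert i (S.erase i)) := by
    intro S _
    rw [fillWeight, Finset.sum_mul]
    refine Finset.sum_congr rfl fun i hi => ?_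
    rw [← hS _ _ (Finset.notMem_erase i S), Finset.insert_erase hi]
  have hR : ∀ O ∈ Finset.powersetCard k (Finset.univ : Finset α),
      (fillWeight p k O * ∑ a, ∑ i ∈ Oᶜ, moveWeight p O a i * V (insert i O)) =
        ∑ i ∈ Oᶜ, fillWeight p k O * (∑ a, moveWeight p O a i) * V (insert i O) := by
    intro O _
    rw [Finset.sum_comm, Finset.mul_sum]
    refine Finset.sum_congr rfl fun i _ => ?_
    rw [← Finset.sum_mul, mul_assoc]
  rw [Finset.sum_congr rfl hL, Finset.sum_congr rfl hR, Finset.sum_sigma', Finset.sum_sigma']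
  refine Finset.sum_bij' (fun x _ => ⟨x.1.erase x.2, x.2⟩) (fun x _ => ⟨insert x.2 x.1, x.2⟩)
    ?_ ?_ ?_ ?_ ?_
  · rintro ⟨S, i⟩ h
    simp only [Finset.mem_sigma, Finset.mem_powersetCard_univ, Finset.mem_compl] at h ⊢
    exact ⟨by rw [Finset.card_erase_of_mem h.2, h.1, Nat.add_sub_cancel],
      Finset.notMem_erase i S⟩
  · rintro ⟨O, i⟩ h
    simp only [Finset.mem_sigma, Finset.mem_powersetCard_univ, Finset.mem_compl] at h ⊢
    exact ⟨by rw [Finset.card_insert_of_notMem h.2, h.1], Finset.mem_insert_self i O⟩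
  · rintro ⟨S, i⟩ h
    simp only [Finset.mem_sigma] at h
    simp only [Finset.insert_erase h.2]
  · rintro ⟨O, i⟩ h
    simp only [Finset.mem_sigma, Finset.mem_compl] at h
    simp only [Finset.erase_insert h.2]
  · rintro ⟨S, i⟩ _
    rfl

end Step

section Free

variable {n : ℕ} {O : Finset (Fin n)} {a : Fin n}

theorem nextFree_eq_some {i : Fin n} :
    nextFree O a = some i ↔ (a < i ∧ i ∉ O) ∧ ∀ x, a < x → x ∉ O → i ≤ x := by
  unfold nextFree
  split_ifs with h
  · rw [Option.some_inj, Finset.min'_eq_iff]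
    simp
  · rw [Finset.not_nonempty_iff_eq_empty, Finset.filter_eq_empty_iff] at h
    simp only [false_iff]
    exact fun hi => h (Finset.mem_univ i) hi.1

theorem prevFree_eq_some {i : Fin n} :
    prevFree O a = some i ↔ (i < a ∧ i ∉ O) ∧ ∀ x, x < a → x ∉ O → x ≤ i := by
  unfold prevFree
  split_ifs with h
  · rw [Option.some_inj, Finset.max'_eq_iff]
    simp
  · rw [Finset.not_nonempty_iff_eq_empty, Finset.filter_eq_empty_iff] at h
    simp only [false_iff]
    exact fun hi => h (Finset.mem_univ i) hi.1

theorem nextFree_eq_none : nextFree O a = none ↔ ∀ x, a < x → x ∈ O := by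
  unfold nextFree
  split_ifs with h
  · obtain ⟨i, hi⟩ := h
    rw [Finset.mem_filter] at hi
    simp only [false_iff]
    exact fun hx => hi.2.2 (hx i hi.2.1)
  · rw [Finset.not_nonempty_iff_eq_empty, Finset.filter_eq_empty_iff] at h
    simpa using h

theorem prevFree_eq_none : prevFree O a = none ↔ ∀ x, x < a → x ∈ O := by
  unfold prevFree
  split_ifs with h
  · obtain ⟨i, hi⟩ := h
    rw [Finset.mem_filter] at hi
    simp only [false_iff]
    exact fun hx => hi.2.2 (hx i hi.2.1)
  · rw [Finset.not_nonempty_iff_eq_empty, Finset.filter_eq_empty_iff] at h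
    simpa using h

theorem sum_ite_eq_some (o : Option (Fin n)) (ho : ∀ i, o = some i → i ∉ O) (V : Fin n → ℝ) :
    ∑ i ∈ Oᶜ, (if o = some i then V i else 0) = o.elim 0 V := by
  rcases o with _ | i₀
  · simp
  · have := ho i₀ rfl
    simp [Finset.sum_ite_eq, this]

theorem sum_moveWeight_mul (p : ℝ) (O : Finset (Fin n)) (a : Fin n) (V : Fin n → ℝ) :
    ∑ i ∈ Oᶜ, moveWeight p O a i * V i =
      if a ∉ O then V a
      else p * (nextFree O a).elim 0 V + (1 - p) * (prevFree O a).elim 0 V := by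
  by_cases ha : a ∉ O
  · rw [if_pos ha, Finset.sum_eq_single_of_mem a (Finset.mem_compl.2 ha)]
    · simp [moveWeight]
    · intro i _ hi
      rcases lt_or_gt_of_ne hi with h | h
      · rw [moveWeight_eq_zero p hi.symm ha (Or.inr ⟨h, le_rfl⟩), zero_mul]
      · rw [moveWeight_eq_zero p hi.symm ha (Or.inl ⟨le_rfl, h⟩), zero_mul]
  · rw [if_neg ha]
    rw [not_not] at ha
    rw [← sum_ite_eq_some (O := O) _ fun i hi => (nextFree_eq_some.1 hi).1.2,
      ← sum_ite_eq_some (O := O) _ fun i hi => (prevFree_eq_some.1 hi).1.2,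
      Finset.mul_sum, Finset.mul_sum, ← Finset.sum_add_distrib]
    refine Finset.sum_congr rfl fun i hi => ?_
    have hi : i ∉ O := Finset.mem_compl.1 hi
    have hai : a ≠ i := fun h => hi (h ▸ ha)
    have h1 : nextFree O a = some i ↔ a < i ∧ ∀ x, a ≤ x → x < i → x ∈ O := by
      rw [nextFree_eq_some]
      constructor
      · rintro ⟨⟨h, -⟩, h'⟩
        refine ⟨h, fun x hx hxi => ?_⟩
        rcases hx.eq_or_lt with rfl | hx
        · exact ha
        · exact not_not.1 fun hxO => (h' x hx hxO).not_gt hxi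
      · rintro ⟨h, h'⟩
        exact ⟨⟨h, hi⟩, fun x hx hxO => not_lt.1 fun hxi => hxO (h' x hx.le hxi)⟩
    have h2 : prevFree O a = some i ↔ i < a ∧ ∀ x, i < x → x ≤ a → x ∈ O := by
      rw [prevFree_eq_some]
      constructor
      · rintro ⟨⟨h, -⟩, h'⟩
        refine ⟨h, fun x hxi hx => ?_⟩
        rcases hx.eq_or_lt with rfl | hx
        · exact ha
        · exact not_not.1 fun hxO => (h' x hx hxO).not_gt hxi
      · rintro ⟨h, h'⟩
        exact ⟨⟨h, hi⟩, fun x hx hxO => not_lt.1 fun hxi => hxO (h' x hxi hx.le)⟩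
    rw [moveWeight, if_neg hai, if_congr h1 rfl rfl, if_congr h2 rfl rfl]
    split_ifs <;> ring

-- The subtracted terms are the chances of running off either end of the street.
open Classical in
theorem sum_moveWeight (p : ℝ) (O : Finset (Fin n)) (a : Fin n) :
    ∑ i ∈ Oᶜ, moveWeight p O a i =
      1 - p * (if ∀ x, a ≤ x → x ∈ O then 1 else 0) -
        (1 - p) * (if ∀ x, x ≤ a → x ∈ O then 1 else 0) := by
  have h := sum_moveWeight_mul p O a fun _ => 1
  simp only [mul_one] at h
  rw [h]
  by_cases ha : a ∈ O
  · have h1 : (∀ x, a ≤ x → x ∈ O) ↔ nextFree O a = none := by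
      rw [nextFree_eq_none]
      refine ⟨fun h x hx => h x hx.le, fun h x hx => ?_⟩
      rcases hx.eq_or_lt with rfl | hx
      · exact ha
      · exact h x hx
    have h2 : (∀ x, x ≤ a → x ∈ O) ↔ prevFree O a = none := by
      rw [prevFree_eq_none]
      refine ⟨fun h x hx => h x hx.le, fun h x hx => ?_⟩
      rcases hx.eq_or_lt with rfl | hx
      · exact ha
      · exact h x hx
    rw [if_neg (not_not.2 ha), if_congr h1 rfl rfl, if_congr h2 rfl rfl]
    rcases nextFree O a <;> rcases prevFree O a <;> simp
  · rw [if_pos ha, if_neg fun h => ha (h a le_rfl), if_neg fun h => ha (h a le_rfl)]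
    ring

/-- The weight with which, after `k` cars have parked on `n` spots, one more car that prefers `a`
parks too. -/
theorem sum_fillWeight_mul_sum_moveWeight (p : ℝ) (k : ℕ) (a : Fin n) :
    ∑ O ∈ Finset.powersetCard k Finset.univ, fillWeight p k O * ∑ i ∈ Oᶜ, moveWeight p O a i =
      totalWeight p k n - p * prefixWeight (1 - p) k n (n - a) -
        (1 - p) * prefixWeight p k n (a + 1) := by
  simp only [sum_moveWeight]
  rw [totalWeight_eq_sum_fin, suffixWeight_eq_sum_fin, prefixWeight_eq_sum_fin, Finset.mul_sum,
    Finset.mul_sum, ← Finset.sum_sub_distrib, ← Finset.sum_sub_distrib]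
  refine Finset.sum_congr rfl fun O _ => ?_
  ring

end Free

/-! ### Closed forms -/

theorem totalWeight_succ (p : ℝ) (k n : ℕ) :
    totalWeight p (k + 1) n = n * totalWeight p k n -
      p * ∑ j ∈ Finset.Icc 1 n, prefixWeight (1 - p) k n j -
        (1 - p) * ∑ j ∈ Finset.Icc 1 n, prefixWeight p k n j := by
  have hIcc : ∀ f : ℕ → ℝ, ∑ j ∈ Finset.Icc 1 n, f j = ∑ a : Fin n, f (a + 1) := by
    intro f
    rw [Fin.sum_univ_eq_sum_range fun i => f (i + 1)]
    refine (Finset.sum_Ico_eq_sum_range f 1 (n + 1)).trans ?_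
    simp [add_comm]
  have hrev : ∀ f : ℕ → ℝ, ∑ j ∈ Finset.Icc 1 n, f j = ∑ a : Fin n, f (n - a) := by
    intro f
    rw [hIcc, ← Equiv.sum_comp Fin.revPerm]
    refine Finset.sum_congr rfl fun a _ => ?_
    congr 1
    simp only [Fin.revPerm_apply, Fin.val_rev]
    omega
  have h := sum_fillWeight_succ (α := Fin n) p k fun _ => 1
  simp only [mul_one] at h
  rw [totalWeight_eq_sum_fin, h]
  simp only [Finset.mul_sum (s := (Finset.univ : Finset (Fin n)))]
  rw [Finset.sum_comm]
  simp only [sum_fillWeight_mul_sum_moveWeight]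
  rw [Finset.sum_sub_distrib, Finset.sum_sub_distrib, ← Finset.mul_sum, ← Finset.mul_sum,
    ← hIcc fun j => prefixWeight p k n j, ← hrev fun j => prefixWeight (1 - p) k n j]
  simp

/-- Absorb `s` by `s * k.choose s = k * (k-1).choose (s-1)`, reverse the order of summation, and
apply Abel's identity with `x = n - k` and `y = k + 1`. -/
theorem sum_range_mul_choose_abel (k n : ℕ) (hk : k + 1 ≤ n) :
    ∑ s ∈ Finset.range (k + 1), (s : ℝ) * (k.choose s * ((s : ℝ) + 1) ^ ((s : ℤ) - 1) *
      (((n : ℝ) - k) * ((n : ℝ) - s) ^ ((k : ℤ) - s - 1))) =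
    k * ((n : ℝ) + 1) ^ ((k : ℤ) - 1) := by
  rcases k with _ | N
  · simp
  · have hx : (0 : ℝ) < n - (N + 1 : ℕ) := by
      rw [sub_pos, Nat.cast_lt]
      omega
    have h := sum_choose_mul_abel hx N ((N : ℝ) + 2)
    rw [← Finset.sum_range_reflect] at h
    have e1 : ((n : ℝ) + 1) ^ (((N + 1 : ℕ) : ℤ) - 1) = (n - (N + 1 : ℕ) + ((N : ℝ) + 2)) ^ N := by
      rw [← zpow_natCast]
      push_cast
      congr 1 <;> ring
    rw [e1, ← h, Finset.sum_range_succ', Finset.mul_sum]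
    simp only [Nat.cast_zero, zero_mul, add_zero]
    refine Finset.sum_congr rfl fun s hs => ?_
    have hs : s ≤ N := Finset.mem_range_succ_iff.1 hs
    have e2 : N + 1 - 1 - s = N - s := by omega
    have e3 : N - (N - s) = s := by omega
    have e4 : ((N - s : ℕ) : ℝ) = N - s := Nat.cast_sub hs
    have e5 : ((N - s : ℕ) : ℤ) = N - s := Nat.cast_sub hs
    have e6 : ((s + 1 : ℕ) : ℝ) * (N + 1).choose (s + 1) = (N + 1 : ℕ) * N.choose s := by
      exact_mod_cast (mul_comm _ _).trans (Nat.add_one_mul_choose_eq N s).symm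
    rw [e2, e3, Nat.choose_symm hs, e4, e5, ← zpow_natCast]
    have e7 : ((s + 1 : ℕ) : ℝ) + 1 = (N : ℝ) + 2 - (N - s) := by push_cast; ring
    have e8 : ((s + 1 : ℕ) : ℤ) - 1 = s := by push_cast; ring
    have e9 : (n : ℝ) - (s + 1 : ℕ) = n - (N + 1 : ℕ) + (N - s) := by push_cast; ring
    have e10 : ((N + 1 : ℕ) : ℤ) - (s + 1 : ℕ) - 1 = N - s - 1 := by push_cast; ring
    rw [e7, e8, e9, e10]
    linear_combination ((N : ℝ) + 2 - (N - s)) ^ (s : ℤ) * ((n : ℝ) - (N + 1 : ℕ)) *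
      (n - (N + 1 : ℕ) + ((N : ℝ) - s)) ^ ((N : ℤ) - s - 1) * e6

/-- The number of parking functions of `k` cars on `n` spots. -/
theorem totalWeight_eq (p : ℝ) {k n : ℕ} (hk : k ≤ n) :
    totalWeight p k n = ((n : ℝ) - k + 1) * ((n : ℝ) + 1) ^ ((k : ℤ) - 1) := by
  -- The recursion involves `1 - p` and shorter streets, so `p` and `n` must vary.
  induction k using Nat.strong_induction_on generalizing p n with
  | _ k ih =>
    rcases k with _ | k
    · have : (n : ℝ) + 1 ≠ 0 := by positivity
      simp [totalWeight, fillWeight, this]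
    · have hsum : ∀ q : ℝ, ∑ j ∈ Finset.Icc 1 n, prefixWeight q k n j =
          k * ((n : ℝ) + 1) ^ ((k : ℤ) - 1) := by
        intro q
        rw [sum_prefixWeight q hk, ← sum_range_mul_choose_abel k n hk]
        refine Finset.sum_congr rfl fun s hs => ?_
        have hs : s ≤ k := Finset.mem_range_succ_iff.1 hs
        rw [ih s (by omega) q le_rfl, ih (k - s) (by omega) q (by omega), Nat.sub_sub,
          Nat.cast_sub (show s + 1 ≤ n by omega), Nat.cast_sub hs, Nat.cast_sub hs]
        push_cast
        ring_nf
      have hn : (n : ℝ) + 1 ≠ 0 := by positivity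
      rw [totalWeight_succ, hsum, hsum, ih k (by omega) p (by omega)]
      have e : ((n : ℝ) + 1) ^ (((k + 1 : ℕ) : ℤ) - 1) =
          ((n : ℝ) + 1) ^ ((k : ℤ) - 1) * (n + 1) := by
        rw [← zpow_add_one₀ hn]
        congr 1
        push_cast
        ring
      rw [e]
      push_cast
      ring

theorem prefixWeight_eq (p : ℝ) {k n : ℕ} (hk : k < n) (j : ℕ) :
    prefixWeight p k n j = ((n : ℝ) - k) * ∑ s ∈ Finset.Icc j k, summand (k + 1) n s := by
  rw [prefixWeight_eq_sum p hk, Finset.mul_sum]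
  refine Finset.sum_congr rfl fun s hs => ?_
  have hs : s ≤ k := (Finset.mem_Icc.1 hs).2
  rw [totalWeight_eq p le_rfl, totalWeight_eq p (by omega), Nat.sub_sub,
    Nat.cast_sub (show s + 1 ≤ n by omega), Nat.cast_sub hs, Nat.cast_sub hs, summand,
    Nat.add_sub_cancel]
  have e : ((k + 1 : ℕ) : ℤ) - s - 2 = (k : ℤ) - s - 1 := by
    push_cast
    ring
  rw [e]
  push_cast
  ring_nf

/-! ### From the parking process to the weights -/

section Park

variable {n : ℕ} (p : unitInterval)

theorem parkList_nil_toReal (O : Finset (Fin n)) : (parkList p O [] true).toReal = 1 := by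
  simp [parkList]

theorem parkList_cons_toReal (O : Finset (Fin n)) (a : Fin n) (l : List (Fin n)) :
    (parkList p O (a :: l) true).toReal =
      ∑ i ∈ Oᶜ, moveWeight p O a i * (parkList p (insert i O) l true).toReal := by
  rw [sum_moveWeight_mul (p : ℝ) O a fun i => (parkList p (insert i O) l true).toReal, parkList,
    parkCar]
  split_ifs with ha
  · rw [PMF.bind_map, PMF.bind_apply, tsum_fintype, Fintype.sum_bool, ENNReal.toReal_add
      (ENNReal.mul_ne_top (PMF.apply_ne_top _ _) (PMF.apply_ne_top _ _))
      (ENNReal.mul_ne_top (PMF.apply_ne_top _ _) (PMF.apply_ne_top _ _)),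
      ENNReal.toReal_mul, ENNReal.toReal_mul]
    simp only [Function.comp_apply, coin, PMF.ofFintype_apply, if_true, Bool.false_eq_true,
      if_false]
    rw [ENNReal.toReal_ofReal p.2.1, ENNReal.toReal_ofReal (sub_nonneg.2 p.2.2)]
    rcases nextFree O a <;> rcases prevFree O a <;> simp
  · rw [PMF.pure_bind]

/-- Links the process, which unfolds from the first car, to `fillWeight`, which unfolds from the
last: each step moves one car from the list into the filled set. -/
theorem sum_fillWeight_mul_sum_parkList (r k : ℕ) (t : List (Fin n)) :
    ∑ O ∈ Finset.powersetCard r Finset.univ, fillWeight (p : ℝ) r O *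
        ∑ α : Fin k → Fin n, (parkList p O (List.ofFn α ++ t) true).toReal =
      ∑ O ∈ Finset.powersetCard (r + k) Finset.univ,
        fillWeight (p : ℝ) (r + k) O * (parkList p O t true).toReal := by
  induction k generalizing r with
  | zero => simp
  | succ k ih =>
    rw [← add_assoc, add_right_comm, ← ih (r + 1), sum_fillWeight_succ]
    refine Finset.sum_congr rfl fun O _ => ?_
    congr 1
    rw [← (Fin.consEquiv fun _ => Fin n).sum_comp, Fintype.sum_prod_type]
    refine Finset.sum_congr rfl fun a _ => ?_
    change ∑ β : Fin k → Fin n,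
      (parkList p O (List.ofFn (Fin.cons a β : Fin (k + 1) → Fin n) ++ t) true).toReal = _
    simp only [List.ofFn_cons, List.cons_append, parkList_cons_toReal]
    rw [Finset.sum_comm]
    simp only [Finset.mul_sum]

theorem sum_parkList (k : ℕ) (t : List (Fin n)) :
    ∑ α : Fin k → Fin n, (parkList p ∅ (List.ofFn α ++ t) true).toReal =
      ∑ O ∈ Finset.powersetCard k Finset.univ,
        fillWeight (p : ℝ) k O * (parkList p O t true).toReal := by
  have h := sum_fillWeight_mul_sum_parkList p 0 k t
  simpa [fillWeight] using h

theorem sum_parkList_eq_totalWeight (k : ℕ) :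
    ∑ α : Fin k → Fin n, (parkList p ∅ (List.ofFn α) true).toReal = totalWeight p k n := by
  have h := sum_parkList (n := n) p k []
  simpa [parkList_nil_toReal, ← totalWeight_eq_sum_fin] using h

theorem sum_parkList_last (k : ℕ) (a : Fin n) :
    ∑ α : Fin (k + 1) → Fin n,
        (if α (Fin.last k) = a then (parkList p ∅ (List.ofFn α) true).toReal else 0) =
      totalWeight p k n - p * prefixWeight (1 - p) k n (n - a) -
        (1 - p) * prefixWeight p k n (a + 1) := by
  rw [← (Fin.snocEquiv fun _ => Fin n).sum_comp, Fintype.sum_prod_type]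
  change ∑ b, ∑ β : Fin k → Fin n,
    (if (Fin.snoc β b : Fin (k + 1) → Fin n) (Fin.last k) = a then
      (parkList p ∅ (List.ofFn (Fin.snoc β b : Fin (k + 1) → Fin n)) true).toReal else 0) = _
  simp only [Fin.snoc_last]
  rw [Finset.sum_eq_single_of_mem a (Finset.mem_univ a)
    fun b _ hb => Finset.sum_eq_zero fun _ _ => if_neg hb]
  simp only [if_true, List.ofFn_succ_last, Fin.snoc_castSucc, Fin.snoc_last]
  -- The list `t` is now `[a]`: only the last car remains to be parked.
  rw [sum_parkList]
  simp only [parkList_cons_toReal, parkList_nil_toReal, mul_one]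
  exact sum_fillWeight_mul_sum_moveWeight _ _ _

end Park

/-! ### Probabilities of the events and conclusion -/

theorem experiment_apply (m n : ℕ) [NeZero n] (p : unitInterval) (ω : (Fin m → Fin n) × Bool) :
    experiment m n p ω =
      (Fintype.card (Fin m → Fin n) : ENNReal)⁻¹ * parkList p ∅ (List.ofFn ω.1) ω.2 := by
  classical
  rw [experiment, PMF.bind_apply, tsum_fintype, Finset.sum_eq_single_of_mem ω.1 (Finset.mem_univ _)]
  · rw [PMF.uniformOfFintype_apply, PMF.map_apply, tsum_fintype,
      Finset.sum_eq_single_of_mem ω.2 (Finset.mem_univ _)]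
    · simp
    · intro b _ hb
      rw [if_neg fun h => hb (congrArg Prod.snd h).symm]
  · intro α _ hα
    rw [PMF.map_apply, tsum_fintype, Finset.sum_eq_zero, mul_zero]
    intro b _
    rw [if_neg fun h => hα (congrArg Prod.fst h).symm]

theorem law_real_allPark_inter (m n : ℕ) [NeZero n] (p : unitInterval)
    (P : (Fin m → Fin n) → Prop) [DecidablePred P] :
    (law m n p).real (allPark m n ∩ {ω | P ω.1}) =
      (Fintype.card (Fin m → Fin n) : ℝ)⁻¹ *
        ∑ α, if P α then (parkList p ∅ (List.ofFn α) true).toReal else 0 := by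
  classical
  rw [MeasureTheory.measureReal_def, law, PMF.toMeasure_apply_fintype,
    ENNReal.toReal_sum, Fintype.sum_prod_type, Finset.mul_sum]
  · refine Finset.sum_congr rfl fun α _ => ?_
    rw [Fintype.sum_bool]
    by_cases hP : P α <;>
      simp [Set.indicator, allPark, experiment_apply, hP, ENNReal.toReal_mul]
  · intro ω _
    rw [Set.indicator_apply]
    split_ifs
    · exact PMF.apply_ne_top _ _
    · exact ENNReal.zero_ne_top

end ProbParking

theorem theorem2p5 (m n : ℕ) [NeZero n] (hm : 1 ≤ m) (hmn : m ≤ n) (p : unitInterval)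
    (j : ℕ) (hj : 1 ≤ j) (hjn : j ≤ n) :
    0 < ProbParking.law m n p (ProbParking.allPark m n) ∧
    (ProbabilityTheory.cond (ProbParking.law m n p) (ProbParking.allPark m n)).real
        (ProbParking.lastPref m n hm j) =
      ((n : ℝ) - m + 2) / (((n : ℝ) - m + 1) * ((n : ℝ) + 1)) -
        1 / ((n : ℝ) + 1) ^ (m - 1) *
          ((p : ℝ) * ∑ s ∈ Finset.Icc (n - j + 1) (m - 1), ProbParking.summand m n s +
            (1 - (p : ℝ)) * ∑ s ∈ Finset.Icc j (m - 1), ProbParking.summand m n s) := by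
  obtain ⟨k, rfl⟩ : ∃ k, m = k + 1 := ⟨m - 1, by omega⟩
  have hk : k < n := hmn
  have hn : (0 : ℝ) < n + 1 := by positivity
  have hnk : (0 : ℝ) < n - k := sub_pos.2 (Nat.cast_lt.2 hk)
  have hN : (Fintype.card (Fin (k + 1) → Fin n) : ℝ) ≠ 0 := Nat.cast_ne_zero.2 Fintype.card_ne_zero
  have htot : (ProbParking.law (k + 1) n p).real (ProbParking.allPark (k + 1) n) =
      (Fintype.card (Fin (k + 1) → Fin n) : ℝ)⁻¹ * (((n : ℝ) - k) * (n + 1) ^ k) := by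
    have h := ProbParking.law_real_allPark_inter (k + 1) n p fun _ => True
    simp only [if_true, Set.ofPred_true, Set.inter_univ, ProbParking.sum_parkList_eq_totalWeight,
      ProbParking.totalWeight_eq (p : ℝ) hmn] at h
    rw [h]
    push_cast
    rw [add_sub_cancel_right, zpow_natCast]
    ring
  let a : Fin n := ⟨j - 1, by omega⟩
  have hlast : ProbParking.lastPref (k + 1) n hm j = {ω | ω.1 (Fin.last k) = a} := by
    ext ω
    change (ω.1 (Fin.last k) : ℕ) + 1 = j ↔ ω.1 (Fin.last k) = a
    rw [Fin.ext_iff]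
    change _ ↔ (ω.1 (Fin.last k) : ℕ) = j - 1
    omega
  have hnum := ProbParking.law_real_allPark_inter (k + 1) n p fun α => α (Fin.last k) = a
  have ha1 : (a : ℕ) + 1 = j := Nat.sub_add_cancel hj
  have ha2 : n - (a : ℕ) = n - j + 1 := by omega
  rw [ProbParking.sum_parkList_last, ha1, ha2, ProbParking.prefixWeight_eq _ hk,
    ProbParking.prefixWeight_eq _ hk, ProbParking.totalWeight_eq _ hk.le] at hnum
  constructor
  · refine (ENNReal.toReal_pos_iff.1 (?_ : 0 <
      (ProbParking.law (k + 1) n p).real (ProbParking.allPark (k + 1) n))).1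
    rw [htot]
    positivity
  · rw [MeasureTheory.measureReal_def, ProbabilityTheory.cond_apply (Set.toFinite _).measurableSet,
      ENNReal.toReal_mul, ENNReal.toReal_inv, ← MeasureTheory.measureReal_def,
      ← MeasureTheory.measureReal_def, hlast, hnum, htot, Nat.add_sub_cancel]
    -- The factor `n - k` of both prefix weights cancels against the one in the total `(n - k) * (n
    -- + 1) ^ k`.
    set A := ∑ s ∈ Finset.Icc (n - j + 1) k, ProbParking.summand (k + 1) n s
    set B := ∑ s ∈ Finset.Icc j k, ProbParking.summand (k + 1) n s
    rw [zpow_sub_one₀ hn.ne', zpow_natCast]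
    push_cast
    have : (n : ℝ) - (k + 1) + 1 = n - k := by ring
    rw [this]
    field_simp
    ring
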